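/- Let $A$ be a nonempty countable alphabet, $\tau\notin A$ and $A_\tau=A\cup\{\tau\}$. BCCS($A$) terms are built from a countably infinite set of variables, the constant $\mathbf 0$, prefixing $\alpha\_$ for $\alpha\in A_\tau$, and binary choice $\_+\_$. The transition relations $\xrightarrow{\alpha}$ between terms are generated by the rules $\alpha t\xrightarrow{\alpha}t$; if $t\xrightarrow{\alpha}t'$ then $t+u\xrightarrow{\alpha}t'$ and $u+t\xrightarrow{\alpha}t'$. Let $\Rightarrow$ be the reflexive-transitive closure of $\xrightarrow{\tau}$, and for $w=a_1\cdots a_k\in A^*$ write $p\stackrel{w}{\Rightarrow}p'$ if $p\Rightarrow\xrightarrow{a_1}\Rightarrow\cdots\Rightarrow\xrightarrow{a_k}\Rightarrow p'$. Let $\mathcal{WT}(p)=\{w\mid \exists p'.\ p\stackrel{w}{\Rightarrow}p'\}$. A pair $(w,B)$ with $w\in A^*$ and $B\subseteq A^*$ is a weak impossible future of $p$ if $p\stackrel{w}{\Rightarrow}p'$ for some $p'$ with $\mathcal{WT}(p')\cap B=\emptyset$. For closed terms $p,q$, write $p\precsim_{\rm WIF}q$ if every weak impossible future of $p$ is one of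 $q$, $\mathcal{WT}(p)=\mathcal{WT}(q)$, and $p\xrightarrow{\tau}$ implies $q\xrightarrow{\tau}$. Let $E$ be the axiomatization consisting of \[ \begin{array}{llcl} \mathrm{A1} & x+y &\approx& y+x\\ \mathrm{A2} & (x+y)+z &\approx& x+(y+z)\\ \mathrm{A3} & x+x &\approx& x\\ \mathrm{A4} & x+\mathbf 0 &\approx& x\\ \mathrm{WIF1} & \alpha(\tau x+\tau y) &\approx& \alpha x+\alpha y \quad(\alpha\in A_\tau)\\ \mathrm{WIF2}' & \tau(x+y) &\preccurlyeq& \tau x+y\\ \mathrm{W1} & x &\preccurlyeq& \tau x \end{array} \] where an equation abbreviates the two corresponding inequations, and let $E\vdash t\preccurlyeq u$ mean that $t\preccurlyeq u$ is derivable from substitution instances of axioms in $E$ by reflexivity, transitivity and closure under prefixing and choice. Then $E$ is finite up to the names of visible actions (it consists of all instances of finitely many inequations in which action names are read as variables ranging over $A$), and literally finite if $A$ is finite. Moreover, $E$ is sound and ground-complete for BCCS($A$) modulo $\precsim_{\rm WIF}$: 1. (Soundness) for all terms $t,u$, if $E\vdash t\preccurlyeq u$, then $\rho(t)\precsim_{\rm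 WIF}\rho(u)$ for every closed substitution $\rho$; 2. (Ground-completeness) for all closed terms $p,q$, if $p\precsim_{\rm WIF}q$, then $E\vdash p\preccurlyeq q$. -/

import Mathlib

namespace BCCS

/-! ### Labelled transition systems and weak impossible futures -/

/-- The set `A ∪ {τ}` of actions over the alphabet `A`: `some a` is the visible action `a`,
`none` is the hidden action `τ`. -/
abbrev Act (A : Type*) := Option A

/-- The hidden action. -/
abbrev tau {A : Type*} : Act A := none

/-- A transition relation on the set of states `S` with labels in `A ∪ {τ}`. -/
abbrev LTS (A S : Type*) := S → Act A → S → Prop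

/-- `s ⇒ s'`: the reflexive transitive closure of the `τ`-transitions. -/
def TauStar {A S : Type*} (step : LTS A S) : S → S → Prop :=
  Relation.ReflTransGen (fun s s' => step s tau s')

/-- `WeakRun step s [a₁, …, aₖ] s'`: there is a sequence
`s ⇒ —a₁→ ⇒ ⋯ ⇒ —aₖ→ ⇒ s'`. -/
inductive WeakRun {A S : Type*} (step : LTS A S) : S → List A → S → Prop
  | nil {s s' : S} : TauStar step s s' → WeakRun step s [] s'
  | cons {s s₁ s₂ s' : S} {a : A} {w : List A} :
      TauStar step s s₁ → step s₁ (some a) s₂ → WeakRun step s₂ w s' →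
      WeakRun step s (a :: w) s'

/-- The set of weak traces of a state. -/
def weakTraces {A S : Type*} (step : LTS A S) (s : S) : Set (List A) :=
  {w | ∃ s', WeakRun step s w s'}

/-- The set of weak impossible futures of a state. -/
def weakImpossibleFutures {A S : Type*} (step : LTS A S) (s : S) :
    Set (List A × Set (List A)) :=
  {f | ∃ s', WeakRun step s f.1 s' ∧ weakTraces step s' ∩ f.2 = ∅}

/-- The weak impossible futures preorder. -/
def WIFle {A S : Type*} (step : LTS A S) (s₁ s₂ : S) : Prop :=
  weakImpossibleFutures step s₁ ⊆ weakImpossibleFutures step s₂ ∧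
  weakTraces step s₁ = weakTraces step s₂ ∧
  ((∃ s', step s₁ tau s') → ∃ s', step s₂ tau s')

/-! ### The process algebra BCCS -/

/-- BCCS terms over the alphabet `A`, with variables drawn from the countably infinite set `ℕ`:
`var x` is a variable, `nil` the constant `0`, `pre α t` the term `α t`,
and `alt t u` the term `t + u`. -/
inductive Term (A : Type*) : Type _
  | var : ℕ → Term A
  | nil : Term A
  | pre : Act A → Term A → Term A
  | alt : Term A → Term A → Term A

namespace Term

/-- The set of variables occurring in a term. -/
def vars {A : Type*} : Term A → Set ℕ
  | var x => {x}
  | nil => ∅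
  | pre _ t => vars t
  | alt t u => vars t ∪ vars u

/-- A term is closed if no variable occurs in it. -/
def Closed {A : Type*} (t : Term A) : Prop := t.vars = ∅

/-- Application of a substitution to a term. -/
def subst {A : Type*} (σ : ℕ → Term A) : Term A → Term A
  | var x => σ x
  | nil => nil
  | pre α t => pre α (subst σ t)
  | alt t u => alt (subst σ t) (subst σ u)

/-- Replacement of every visible action `b` in a term by `f b`; the action `τ` is kept. -/
def relabel {A B : Type*} (f : B → A) : Term B → Term A
  | var x => var x
  | nil => nil
  | pre α t => pre (α.map f) (relabel f t)
  | alt t u => alt (relabel f t) (relabel f u)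

/-- The operational semantics; variables have no transitions. -/
inductive Step {A : Type*} : Term A → Act A → Term A → Prop
  | pre (α : Act A) (t : Term A) : Step (pre α t) α t
  | altLeft {t u t' : Term A} {α : Act A} : Step t α t' → Step (alt t u) α t'
  | altRight {t u u' : Term A} {α : Act A} : Step u α u' → Step (alt t u) α u'

end Term

/-- The weak impossible futures preorder on BCCS terms. -/
def TermWIFle {A : Type*} (p q : Term A) : Prop := WIFle (Term.Step (A := A)) p q

/-! ### Inequational logic -/

/-- The pair `(t, u)` stands for the inequation `t ≼ u`. -/
abbrev Ineq (A : Type*) := Term A × Term A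

/-- `Derivable E t u`: the inequation `t ≼ u` is derivable from the axiomatization `E`
by inequational logic. -/
inductive Derivable {A : Type*} (E : Set (Ineq A)) : Term A → Term A → Prop
  | ax {t u : Term A} (σ : ℕ → Term A) : (t, u) ∈ E → Derivable E (t.subst σ) (u.subst σ)
  | refl (t : Term A) : Derivable E t t
  | trans {t u v : Term A} : Derivable E t u → Derivable E u v → Derivable E t v
  | pre {t u : Term A} (α : Act A) : Derivable E t u → Derivable E (.pre α t) (.pre α u)
  | alt {t₁ u₁ t₂ u₂ : Term A} : Derivable E t₁ u₁ → Derivable E t₂ u₂ →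
      Derivable E (.alt t₁ t₂) (.alt u₁ u₂)

/-- Soundness modulo a relation `R` on closed terms: every derivable inequation holds under
every closed substitution. -/
def Sound {A : Type*} (E : Set (Ineq A)) (R : Term A → Term A → Prop) : Prop :=
  ∀ t u : Term A, Derivable E t u →
    ∀ ρ : ℕ → Term A, (∀ x, (ρ x).Closed) → R (t.subst ρ) (u.subst ρ)

/-- Ground-completeness modulo a relation `R` on closed terms. -/
def GroundComplete {A : Type*} (E : Set (Ineq A)) (R : Term A → Term A → Prop) : Prop :=
  ∀ p q : Term A, p.Closed → q.Closed → R p q → Derivable E p q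

/-- `E` is given by finitely many axioms in which action names are read as variables ranging
over `A`: the members of `E` are the instances of finitely many inequations over a set `ℕ` of
action variables. -/
def FiniteUpToActionNames {A : Type*} (E : Set (Ineq A)) : Prop :=
  ∃ S : Set (Ineq ℕ), S.Finite ∧
    E = {e | ∃ s ∈ S, ∃ f : ℕ → A, e = (s.1.relabel f, s.2.relabel f)}

/-! ### The axioms -/

/-- An equation `t ≈ u` abbreviates the inequations `t ≼ u` and `u ≼ t`. -/
def equation {A : Type*} (t u : Term A) : Set (Ineq A) := {(t, u), (u, t)}

section Axioms

open Term

/-- The variable `x`. -/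
abbrev vx {A : Type*} : Term A := var 0

/-- The variable `y`. -/
abbrev vy {A : Type*} : Term A := var 1

/-- The variable `z`. -/
abbrev vz {A : Type*} : Term A := var 2

/-- `x + y ≈ y + x`. -/
def axA1 (A : Type*) : Set (Ineq A) := equation (alt vx vy) (alt vy vx)

/-- `(x + y) + z ≈ x + (y + z)`. -/
def axA2 (A : Type*) : Set (Ineq A) := equation (alt (alt vx vy) vz) (alt vx (alt vy vz))

/-- `x + x ≈ x`. -/
def axA3 (A : Type*) : Set (Ineq A) := equation (alt vx vx) vx

/-- `x + 0 ≈ x`. -/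
def axA4 (A : Type*) : Set (Ineq A) := equation (alt vx nil) vx

/-- `α(τ x + τ y) ≈ α x + α y`. -/
def axWIF1 {A : Type*} (α : Act A) : Set (Ineq A) :=
  equation (pre α (alt (pre tau vx) (pre tau vy))) (alt (pre α vx) (pre α vy))

/-- `τ(x + y) ≼ τ x + y`. -/
def axWIF2' (A : Type*) : Set (Ineq A) := {(pre tau (alt vx vy), alt (pre tau vx) vy)}

/-- `x ≼ τ x`. -/
def axW1 (A : Type*) : Set (Ineq A) := {(vx, pre tau vx)}

/-- The axiomatization A1-4 + WIF1 + WIF2' + W1, with an instance of WIF1 for every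
`α ∈ A ∪ {τ}`. -/
def wifAxioms (A : Type*) : Set (Ineq A) :=
  axA1 A ∪ axA2 A ∪ axA3 A ∪ axA4 A ∪ (⋃ α : Act A, axWIF1 α) ∪ axWIF2' A ∪ axW1 A

end Axioms

end BCCS

/-! The preorder has a run-based form (`termWIFle_iff`): `p` is below `q` iff `q` has no weak traces
beyond those of `p`, and every weak run of `p` with at least one transition is matched by such a run
of `q`, with the same label, to a state with no more weak traces. In this form soundness is a check
of each axiom and of the two congruence rules.

Ground-completeness is proved in the quotient by provable equality, an idempotent commutative monoid
with monotone prefixing. The two halves of the characterisation give `p ≤ p + q`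
(`cls_le_add_of_weakTraces_subset`) and `p + q ≤ q` (`add_le_of_dominated`), each by induction on
the term being added or dropped. Both rest on saturation: a term absorbs `τ p'` for each of its
proper `τ`-derivatives `p'` (`cls_add_tau_of_strictRun`), and WIF1 merges all weak `a`-derivatives
into a single absorbed summand `a s` (`exists_derivative`). -/

namespace BCCS

variable {A : Type*}

open Term

/-! ### Weak runs with at least one transition -/

/-- A weak run that performs at least one transition. -/
def StrictRun (p : Term A) (w : List A) (p' : Term A) : Prop :=
  ∃ α p₁ v, Step p α p₁ ∧ w = α.toList ++ v ∧ WeakRun Step p₁ v p'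

theorem WeakRun.tauStep {S : Type*} {step : LTS A S} {s s₁ s' : S} {w : List A}
    (h : step s tau s₁) (hr : WeakRun step s₁ w s') : WeakRun step s w s' := by
  cases hr with
  | nil h' => exact .nil (.head h h')
  | cons h₁ h₂ h₃ => exact .cons (.head h h₁) h₂ h₃

theorem WeakRun.self {S : Type*} {step : LTS A S} (s : S) : WeakRun step s [] s :=
  .nil .refl

theorem StrictRun.weakRun {p p' : Term A} {w : List A} (h : StrictRun p w p') :
    WeakRun Step p w p' := by
  obtain ⟨α, p₁, v, hs, rfl, hr⟩ := h
  cases α with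
  | none => exact hr.tauStep hs
  | some a => exact .cons .refl hs hr

theorem weakRun_iff {p p' : Term A} {w : List A} :
    WeakRun Step p w p' ↔ (w = [] ∧ p' = p) ∨ StrictRun p w p' := by
  constructor
  · intro h
    cases h with
    | nil h =>
      rcases Relation.ReflTransGen.cases_head h with rfl | ⟨c, h₁, h₂⟩
      · exact .inl ⟨rfl, rfl⟩
      · exact .inr ⟨none, c, [], h₁, rfl, .nil h₂⟩
    | cons h₁ h₂ h₃ =>
      rcases Relation.ReflTransGen.cases_head h₁ with rfl | ⟨c, h₄, h₅⟩
      · exact .inr ⟨_, _, _, h₂, rfl, h₃⟩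
      · exact .inr ⟨none, c, _, h₄, rfl, .cons h₅ h₂ h₃⟩
  · rintro (⟨rfl, rfl⟩ | h)
    · exact .self _
    · exact h.weakRun

theorem mem_weakTraces_iff {p : Term A} {w : List A} :
    w ∈ weakTraces Step p ↔ w = [] ∨ ∃ p', StrictRun p w p' := by
  simp only [weakTraces, Set.mem_ofPred_eq, weakRun_iff]
  constructor
  · rintro ⟨p', ⟨h, -⟩ | h⟩
    exacts [.inl h, .inr ⟨p', h⟩]
  · rintro (h | ⟨p', h⟩)
    exacts [⟨p, .inl ⟨h, rfl⟩⟩, ⟨p', .inr h⟩]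

theorem not_strictRun_nil {p' : Term A} {w : List A} : ¬ StrictRun nil w p' := by
  rintro ⟨α, p₁, v, hs, -⟩
  cases hs

/-- This fails for arbitrary weak runs: the empty run ends in the sum itself, not in a summand. -/
theorem strictRun_alt {t u p' : Term A} {w : List A} :
    StrictRun (alt t u) w p' ↔ StrictRun t w p' ∨ StrictRun u w p' := by
  constructor
  · rintro ⟨α, p₁, v, hs, h⟩
    cases hs with
    | altLeft hs => exact .inl ⟨α, p₁, v, hs, h⟩
    | altRight hs => exact .inr ⟨α, p₁, v, hs, h⟩
  · rintro (⟨α, p₁, v, hs, h⟩ | ⟨α, p₁, v, hs, h⟩)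
    · exact ⟨α, p₁, v, .altLeft hs, h⟩
    · exact ⟨α, p₁, v, .altRight hs, h⟩

theorem strictRun_pre {α : Act A} {t p' : Term A} {w : List A} :
    StrictRun (pre α t) w p' ↔ ∃ v, w = α.toList ++ v ∧ WeakRun Step t v p' := by
  constructor
  · rintro ⟨β, p₁, v, hs, h⟩
    cases hs
    exact ⟨v, h⟩
  · rintro ⟨v, h⟩
    exact ⟨α, t, v, .pre α t, h⟩

theorem strictRun_tau {t p' : Term A} {w : List A} :
    StrictRun (pre tau t) w p' ↔ WeakRun Step t w p' := by
  simp [strictRun_pre]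

theorem strictRun_act {a : A} {t p' : Term A} {w : List A} :
    StrictRun (pre (some a) t) w p' ↔ ∃ v, w = a :: v ∧ WeakRun Step t v p' := by
  simp [strictRun_pre]

theorem weakTraces_subset_of_tauStar {p p' : Term A} (h : WeakRun Step p [] p') :
    weakTraces Step p' ⊆ weakTraces Step p := by
  rintro w ⟨p'', hw⟩
  cases h with
  | nil h =>
    refine ⟨p'', ?_⟩
    induction h using Relation.ReflTransGen.head_induction_on with
    | refl => exact hw
    | head h _ ih => exact ih.tauStep h

theorem weakTraces_alt {t u : Term A} :
    weakTraces Step (alt t u) = weakTraces Step t ∪ weakTraces Step u := by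
  ext w
  simp only [Set.mem_union, mem_weakTraces_iff, strictRun_alt, exists_or]
  tauto

theorem mem_weakTraces_pre {α : Act A} {t : Term A} {w : List A} :
    w ∈ weakTraces Step (pre α t) ↔ w = [] ∨ ∃ v ∈ weakTraces Step t, w = α.toList ++ v := by
  rw [mem_weakTraces_iff]
  simp only [strictRun_pre, weakTraces, Set.mem_ofPred_eq]
  constructor
  · rintro (h | ⟨p', v, h, hr⟩)
    exacts [.inl h, .inr ⟨v, ⟨p', hr⟩, h⟩]
  · rintro (h | ⟨v, ⟨p', hr⟩, h⟩)
    exacts [.inl h, .inr ⟨p', v, h, hr⟩]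

theorem nil_mem_weakTraces (p : Term A) : [] ∈ weakTraces Step p := ⟨p, .self p⟩

theorem weakTraces_tau {t : Term A} : weakTraces Step (pre tau t) = weakTraces Step t := by
  ext w
  rw [mem_weakTraces_pre]
  simp only [Option.toList_none, List.nil_append, exists_eq_right']
  exact or_iff_right_of_imp fun h => h ▸ nil_mem_weakTraces t

/-! ### Domination -/

/-- Every nonempty weak run of `p` is matched by a nonempty weak run of `q` with the same
visible actions that leads to a state with fewer weak traces. -/
def Dominated (p q : Term A) : Prop :=
  ∀ w p', StrictRun p w p' → ∃ q', StrictRun q w q' ∧ weakTraces Step q' ⊆ weakTraces Step p'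

theorem Dominated.weakTraces_subset {p q : Term A} (h : Dominated p q) :
    weakTraces Step p ⊆ weakTraces Step q := by
  intro w hw
  rw [mem_weakTraces_iff] at hw ⊢
  rcases hw with hw | ⟨p', hp⟩
  · exact .inl hw
  · obtain ⟨q', hq, -⟩ := h w p' hp
    exact .inr ⟨q', hq⟩

/-- The sharpest impossible future witnessed by `p'` takes for `B` the complement of its weak
traces. The `τ`-clause of the preorder is what lets nonempty runs be matched by nonempty ones. -/
theorem termWIFle_iff {p q : Term A} :
    TermWIFle p q ↔ Dominated p q ∧ weakTraces Step q ⊆ weakTraces Step p := by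
  constructor
  · rintro ⟨h₁, h₂, h₃⟩
    refine ⟨fun w p' hp => ?_, h₂.ge⟩
    obtain ⟨q', hq, hB⟩ := h₁ (a := (w, (weakTraces Step p')ᶜ))
      ⟨p', hp.weakRun, Set.inter_compl_self _⟩
    have hsub : weakTraces Step q' ⊆ weakTraces Step p' := by
      rwa [← Set.disjoint_iff_inter_eq_empty, Set.disjoint_compl_right_iff_subset] at hB
    -- If the matching run is empty, the run of `p` has empty label and so starts with `τ`; the
    -- `τ`-clause then gives `q` a `τ`-step, which can only shrink the trace set.
    rcases weakRun_iff.1 hq with ⟨hw, rfl⟩ | hq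
    · dsimp only at hw
      subst hw
      obtain ⟨α, p₁, v, hs, hv, -⟩ := hp
      cases α with
      | some a => simp at hv
      | none =>
        obtain ⟨q₁, hq₁⟩ := h₃ ⟨p₁, hs⟩
        have hr : StrictRun q' [] q₁ := ⟨none, q₁, [], hq₁, rfl, .self q₁⟩
        exact ⟨q₁, hr, (weakTraces_subset_of_tauStar hr.weakRun).trans hsub⟩
    · exact ⟨q', hq, hsub⟩
  · rintro ⟨h₁, h₂⟩
    refine ⟨?_, h₁.weakTraces_subset.antisymm h₂, ?_⟩
    · rintro ⟨w, B⟩ ⟨p', hp, hB⟩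
      rcases weakRun_iff.1 hp with ⟨hw, rfl⟩ | hp
      · dsimp only at hw
        subst hw
        exact ⟨q, .self q, Set.subset_empty_iff.1 (hB ▸ Set.inter_subset_inter_left _ h₂)⟩
      · obtain ⟨q', hq, hs⟩ := h₁ w p' hp
        exact ⟨q', hq.weakRun, Set.subset_empty_iff.1 (hB ▸ Set.inter_subset_inter_left _ hs)⟩
    · rintro ⟨p', hp⟩
      obtain ⟨q', ⟨α, q₁, v, hs, hv, -⟩, -⟩ :=
        h₁ [] p' ⟨none, p', [], hp, rfl, .self p'⟩
      cases α with
      | none => exact ⟨q₁, hs⟩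
      | some a => simp at hv

theorem TermWIFle.of_strictRun_imp {p q : Term A}
    (h : ∀ w p', StrictRun p w p' → StrictRun q w p')
    (h' : weakTraces Step q ⊆ weakTraces Step p) : TermWIFle p q :=
  termWIFle_iff.2 ⟨fun w p' hp => ⟨p', h w p' hp, subset_rfl⟩, h'⟩

theorem TermWIFle.of_strictRun_iff {p q : Term A}
    (h : ∀ w p', StrictRun p w p' ↔ StrictRun q w p') : TermWIFle p q := by
  refine .of_strictRun_imp (fun w p' => (h w p').1) fun w hw => ?_
  simpa only [mem_weakTraces_iff, h] using hw

theorem TermWIFle.refl (p : Term A) : TermWIFle p p := .of_strictRun_iff fun _ _ => Iff.rfl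

theorem TermWIFle.trans {p q r : Term A} (h : TermWIFle p q) (h' : TermWIFle q r) :
    TermWIFle p r :=
  ⟨h.1.trans h'.1, h.2.1.trans h'.2.1, fun hp => h'.2.2 (h.2.2 hp)⟩

/-- Needed under a prefix, where the remaining run may be empty; then `q` itself is the match. -/
theorem TermWIFle.exists_weakRun {p q p' : Term A} {w : List A} (h : TermWIFle p q)
    (hp : WeakRun Step p w p') :
    ∃ q', WeakRun Step q w q' ∧ weakTraces Step q' ⊆ weakTraces Step p' := by
  obtain ⟨h₁, h₂⟩ := termWIFle_iff.1 h
  rcases weakRun_iff.1 hp with ⟨rfl, rfl⟩ | hp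
  · exact ⟨q, .self q, h₂⟩
  · obtain ⟨q', hq, hs⟩ := h₁ w p' hp
    exact ⟨q', hq.weakRun, hs⟩

theorem TermWIFle.pre {p q : Term A} (α : Act A) (h : TermWIFle p q) :
    TermWIFle (pre α p) (pre α q) := by
  refine termWIFle_iff.2 ⟨fun w p' hp => ?_, fun w hw => ?_⟩
  · obtain ⟨v, hw, hr⟩ := strictRun_pre.1 hp
    obtain ⟨q', hq, hs⟩ := h.exists_weakRun hr
    exact ⟨q', strictRun_pre.2 ⟨v, hw, hq⟩, hs⟩
  · simpa only [mem_weakTraces_pre, h.2.1] using hw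

theorem TermWIFle.alt {p q r s : Term A} (h : TermWIFle p q) (h' : TermWIFle r s) :
    TermWIFle (alt p r) (alt q s) := by
  refine termWIFle_iff.2 ⟨fun w p' hp => ?_, ?_⟩
  · rcases strictRun_alt.1 hp with hp | hp
    · obtain ⟨q', hq, hs⟩ := (termWIFle_iff.1 h).1 w p' hp
      exact ⟨q', strictRun_alt.2 (.inl hq), hs⟩
    · obtain ⟨q', hq, hs⟩ := (termWIFle_iff.1 h').1 w p' hp
      exact ⟨q', strictRun_alt.2 (.inr hq), hs⟩
  · rw [weakTraces_alt, weakTraces_alt, h.2.1, h'.2.1]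

/-! ### Soundness -/

theorem termWIFle_WIF1_left (α : Act A) (x y : Term A) :
    TermWIFle (pre α (alt (pre tau x) (pre tau y))) (alt (pre α x) (pre α y)) := by
  refine termWIFle_iff.2 ⟨fun w p' hp => ?_, fun w hw => ?_⟩
  · obtain ⟨v, hw, hr⟩ := strictRun_pre.1 hp
    rcases weakRun_iff.1 hr with ⟨rfl, rfl⟩ | hr
    -- A run stopping at `τ x + τ y` has no counterpart with the same endpoint; stopping at `x`
    -- gives fewer traces.
    · refine ⟨x, strictRun_alt.2 (.inl (strictRun_pre.2 ⟨[], hw, .self x⟩)), ?_⟩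
      rw [weakTraces_alt, weakTraces_tau]
      exact Set.subset_union_left
    · rw [strictRun_alt, strictRun_tau, strictRun_tau] at hr
      exact ⟨p', strictRun_alt.2 (hr.imp (fun h => strictRun_pre.2 ⟨v, hw, h⟩)
        (fun h => strictRun_pre.2 ⟨v, hw, h⟩)), subset_rfl⟩
  · simp only [weakTraces_alt, Set.mem_union, mem_weakTraces_pre (α := α), weakTraces_tau] at hw ⊢
    grind

theorem termWIFle_WIF1_right (α : Act A) (x y : Term A) :
    TermWIFle (alt (pre α x) (pre α y)) (pre α (alt (pre tau x) (pre tau y))) := by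
  refine .of_strictRun_imp (fun w p' hp => ?_) fun w hw => ?_
  · rw [strictRun_alt, strictRun_pre, strictRun_pre] at hp
    rw [strictRun_pre]
    rcases hp with ⟨v, hv, h⟩ | ⟨v, hv, h⟩
    · exact ⟨v, hv, (strictRun_alt.2 (.inl (strictRun_tau.2 h))).weakRun⟩
    · exact ⟨v, hv, (strictRun_alt.2 (.inr (strictRun_tau.2 h))).weakRun⟩
  · simp only [weakTraces_alt, Set.mem_union, mem_weakTraces_pre (α := α), weakTraces_tau] at hw ⊢
    grind

theorem termWIFle_WIF2' (x y : Term A) :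
    TermWIFle (pre tau (alt x y)) (alt (pre tau x) y) := by
  refine termWIFle_iff.2 ⟨fun w p' hp => ?_, ?_⟩
  · rw [strictRun_tau] at hp
    rcases weakRun_iff.1 hp with ⟨rfl, rfl⟩ | hp
    · refine ⟨x, strictRun_alt.2 (.inl (strictRun_tau.2 (.self x))), ?_⟩
      rw [weakTraces_alt]
      exact Set.subset_union_left
    · exact ⟨p', strictRun_alt.2 ((strictRun_alt.1 hp).imp
        (fun h => strictRun_tau.2 h.weakRun) id), subset_rfl⟩
  · simp only [weakTraces_alt, weakTraces_tau, subset_rfl]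

theorem termWIFle_W1 (x : Term A) : TermWIFle x (pre tau x) :=
  .of_strictRun_imp (fun _ _ hp => strictRun_tau.2 hp.weakRun) weakTraces_tau.le

theorem termWIFle_of_mem_wifAxioms {t u : Term A} (h : (t, u) ∈ wifAxioms A)
    (σ : ℕ → Term A) : TermWIFle (t.subst σ) (u.subst σ) := by
  simp only [wifAxioms, axA1, axA2, axA3, axA4, axWIF1, axWIF2', axW1, equation, Set.mem_union,
    Set.mem_insert_iff, Set.mem_singleton_iff, Set.mem_iUnion, Prod.mk.injEq] at h
  rcases h with (((((h | h) | h) | h) | ⟨α, h⟩) | h) | h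
  on_goal 5 =>
    rcases h with ⟨rfl, rfl⟩ | ⟨rfl, rfl⟩
    exacts [termWIFle_WIF1_left α _ _, termWIFle_WIF1_right α _ _]
  on_goal 5 =>
    obtain ⟨rfl, rfl⟩ := h
    exact termWIFle_WIF2' _ _
  on_goal 5 =>
    obtain ⟨rfl, rfl⟩ := h
    exact termWIFle_W1 _
  -- A1–A4 leave the nonempty runs unchanged, endpoints included.
  all_goals
    rcases h with ⟨rfl, rfl⟩ | ⟨rfl, rfl⟩ <;> refine .of_strictRun_iff fun w p' => ?_ <;>
      simp only [subst, strictRun_alt, not_strictRun_nil] <;> tauto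

theorem subst_subst (σ ρ : ℕ → Term A) (t : Term A) :
    (t.subst σ).subst ρ = t.subst fun n => (σ n).subst ρ := by
  induction t <;> simp_all [subst]

theorem sound_wifAxioms : Sound (wifAxioms A) TermWIFle := by
  intro t u h ρ _
  induction h with
  | ax σ h =>
    rw [subst_subst, subst_subst]
    exact termWIFle_of_mem_wifAxioms h _
  | refl t => exact .refl _
  | trans _ _ h₁ h₂ => exact h₁.trans h₂
  | pre α _ h => exact h.pre α
  | alt _ _ h₁ h₂ => exact h₁.alt h₂

/-! ### Finiteness -/

theorem finite_wifAxioms [Finite A] : (wifAxioms A).Finite := by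
  have h : ∀ t u : Term A, (equation t u).Finite := fun t u => Set.toFinite {(t, u), (u, t)}
  exact ((((((h _ _).union (h _ _)).union (h _ _)).union (h _ _)).union
    (Set.finite_iUnion fun _ => h _ _)).union (Set.finite_singleton _)).union
    (Set.finite_singleton _)

theorem finiteUpToActionNames_wifAxioms [Nonempty A] :
    FiniteUpToActionNames (wifAxioms A) := by
  have h : ∀ t u : Term ℕ, (equation t u).Finite := fun t u => Set.toFinite {(t, u), (u, t)}
  -- Relabelling fixes `τ`, so WIF1 needs two schemes: one for `τ`, one for the action variable `0`.
  refine ⟨axA1 ℕ ∪ axA2 ℕ ∪ axA3 ℕ ∪ axA4 ℕ ∪ (axWIF1 none ∪ axWIF1 (some 0)) ∪ axWIF2' ℕ ∪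
    axW1 ℕ, ((((((h _ _).union (h _ _)).union (h _ _)).union (h _ _)).union
    ((h _ _).union (h _ _))).union (Set.finite_singleton _)).union (Set.finite_singleton _), ?_⟩
  -- Even an axiom without visible actions is an instance only if some map `ℕ → A` exists.
  obtain ⟨a₀⟩ := ‹Nonempty A›
  ext e
  simp only [wifAxioms, axA1, axA2, axA3, axA4, axWIF1, axWIF2', axW1, equation, Set.mem_union,
    Set.mem_insert_iff, Set.mem_singleton_iff, Set.mem_iUnion, Set.mem_ofPred_eq]
  constructor
  · rintro (((((((rfl | rfl) | (rfl | rfl)) | (rfl | rfl)) | (rfl | rfl)) | ⟨α, h⟩) | rfl) | rfl)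
    on_goal 9 =>
      cases α with
      | none =>
        rcases h with rfl | rfl
        · exact ⟨_, .inl (.inl (.inr (.inl (.inl rfl)))), fun _ => a₀, rfl⟩
        · exact ⟨_, .inl (.inl (.inr (.inl (.inr rfl)))), fun _ => a₀, rfl⟩
      | some a =>
        rcases h with rfl | rfl
        · exact ⟨_, .inl (.inl (.inr (.inr (.inl rfl)))), fun _ => a, rfl⟩
        · exact ⟨_, .inl (.inl (.inr (.inr (.inr rfl)))), fun _ => a, rfl⟩
    · exact ⟨_, .inl (.inl (.inl (.inl (.inl (.inl (.inl rfl)))))), fun _ => a₀, rfl⟩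
    · exact ⟨_, .inl (.inl (.inl (.inl (.inl (.inl (.inr rfl)))))), fun _ => a₀, rfl⟩
    · exact ⟨_, .inl (.inl (.inl (.inl (.inl (.inr (.inl rfl)))))), fun _ => a₀, rfl⟩
    · exact ⟨_, .inl (.inl (.inl (.inl (.inl (.inr (.inr rfl)))))), fun _ => a₀, rfl⟩
    · exact ⟨_, .inl (.inl (.inl (.inl (.inr (.inl rfl))))), fun _ => a₀, rfl⟩
    · exact ⟨_, .inl (.inl (.inl (.inl (.inr (.inr rfl))))), fun _ => a₀, rfl⟩
    · exact ⟨_, .inl (.inl (.inl (.inr (.inl rfl)))), fun _ => a₀, rfl⟩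
    · exact ⟨_, .inl (.inl (.inl (.inr (.inr rfl)))), fun _ => a₀, rfl⟩
    · exact ⟨_, .inl (.inr rfl), fun _ => a₀, rfl⟩
    · exact ⟨_, .inr rfl, fun _ => a₀, rfl⟩
  · rintro ⟨s, hs, f, rfl⟩
    rcases hs with ((((((rfl | rfl) | (rfl | rfl)) | (rfl | rfl)) | (rfl | rfl)) |
      ((rfl | rfl) | (rfl | rfl))) | rfl) | rfl
    · exact .inl (.inl (.inl (.inl (.inl (.inl (.inl rfl))))))
    · exact .inl (.inl (.inl (.inl (.inl (.inl (.inr rfl))))))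
    · exact .inl (.inl (.inl (.inl (.inl (.inr (.inl rfl))))))
    · exact .inl (.inl (.inl (.inl (.inl (.inr (.inr rfl))))))
    · exact .inl (.inl (.inl (.inl (.inr (.inl rfl)))))
    · exact .inl (.inl (.inl (.inl (.inr (.inr rfl)))))
    · exact .inl (.inl (.inl (.inr (.inl rfl))))
    · exact .inl (.inl (.inl (.inr (.inr rfl))))
    · exact .inl (.inl (.inr ⟨none, .inl rfl⟩))
    · exact .inl (.inl (.inr ⟨none, .inr rfl⟩))
    · exact .inl (.inl (.inr ⟨some (f 0), .inl rfl⟩))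
    · exact .inl (.inl (.inr ⟨some (f 0), .inr rfl⟩))
    · exact .inl (.inr rfl)
    · exact .inr rfl

/-! ### Terms up to provable equality -/

/-- The preorder of provable inequations. -/
instance : Preorder (Term A) where
  le := Derivable (wifAxioms A)
  le_refl := .refl
  le_trans _ _ _ := .trans

/-- Terms up to provable equality. -/
abbrev Proc (A : Type*) := Antisymmetrization (Term A) (· ≤ ·)

/-- The class of a term. -/
abbrev cls (t : Term A) : Proc A := toAntisymmetrization (· ≤ ·) t

theorem cls_le {t u : Term A} : cls t ≤ cls u ↔ Derivable (wifAxioms A) t u := Iff.rfl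

/-- The substitution that maps the first three variables to the given terms. -/
def subst3 (t u v : Term A) : ℕ → Term A
  | 0 => t
  | 1 => u
  | _ => v

theorem cls_eq_of_equation {t u : Term A} (h : equation t u ⊆ wifAxioms A) (σ : ℕ → Term A) :
    cls (t.subst σ) = cls (u.subst σ) :=
  le_antisymm (cls_le.2 (.ax σ (h (.inl rfl)))) (cls_le.2 (.ax σ (h (.inr rfl))))

/-- Choice on classes. -/
instance : Add (Proc A) where
  add := Quotient.map₂ alt fun _ _ h _ _ h' => ⟨.alt h.1 h'.1, .alt h.2 h'.2⟩

/-- The class of the constant `0`. -/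
instance : Zero (Proc A) where
  zero := cls nil

/-- Prefixing on classes. -/
def act (α : Act A) : Proc A → Proc A :=
  Quotient.map (pre α) fun _ _ h => ⟨.pre α h.1, .pre α h.2⟩

theorem cls_alt (t u : Term A) : cls (alt t u) = cls t + cls u := rfl

theorem cls_pre (α : Act A) (t : Term A) : cls (pre α t) = act α (cls t) := rfl

namespace Proc

theorem ind {P : Proc A → Prop} (h : ∀ t, P (cls t)) (x : Proc A) : P x :=
  Quotient.ind h x

theorem add_self (x : Proc A) : x + x = x := by
  induction x using ind with | h t
  exact cls_eq_of_equation (t := alt vx vx) (u := vx) (fun _ h => by simp [wifAxioms, axA3, h]) (subst3 t t t)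

theorem act_add (α : Act A) (x y : Proc A) :
    act α (act tau x + act tau y) = act α x + act α y := by
  induction x using ind with | h t
  induction y using ind with | h u
  exact cls_eq_of_equation (t := pre α (alt (pre tau vx) (pre tau vy)))
    (u := alt (pre α vx) (pre α vy))
    (fun _ h => .inl (.inl (.inr (Set.mem_iUnion.2 ⟨α, h⟩)))) (subst3 t u t)

theorem tau_add_le (x y : Proc A) : act tau (x + y) ≤ act tau x + y := by
  induction x using ind with | h t
  induction y using ind with | h u
  exact cls_le.2 (.ax (subst3 t u t) (t := pre tau (alt vx vy)) (u := alt (pre tau vx) vy)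
    (.inl (.inr rfl)))

theorem le_tau (x : Proc A) : x ≤ act tau x := by
  induction x using ind with | h t
  exact cls_le.2 (.ax (subst3 t t t) (t := vx) (u := pre tau vx) (.inr rfl))

instance : AddCommMonoid (Proc A) where
  add_assoc x y z := by
    induction x using ind with | h t
    induction y using ind with | h u
    induction z using ind with | h v
    exact cls_eq_of_equation (t := alt (alt vx vy) vz) (u := alt vx (alt vy vz))
      (fun _ h => by simp [wifAxioms, axA2, h]) (subst3 t u v)
  zero_add x := by
    induction x using ind with | h t
    exact (cls_eq_of_equation (t := alt vx vy) (u := alt vy vx)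
      (fun _ h => by simp [wifAxioms, axA1, h]) (subst3 nil t t)).trans
      (cls_eq_of_equation (t := alt vx nil) (u := vx)
      (fun _ h => by simp [wifAxioms, axA4, h]) (subst3 t t t))
  add_zero x := by
    induction x using ind with | h t
    exact cls_eq_of_equation (t := alt vx nil) (u := vx)
      (fun _ h => by simp [wifAxioms, axA4, h]) (subst3 t t t)
  add_comm x y := by
    induction x using ind with | h t
    induction y using ind with | h u
    exact cls_eq_of_equation (t := alt vx vy) (u := alt vy vx)
      (fun _ h => by simp [wifAxioms, axA1, h]) (subst3 t u t)
  nsmul := nsmulRec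

theorem add_mono {x y z w : Proc A} (h : x ≤ y) (h' : z ≤ w) : x + z ≤ y + w := by
  induction x using ind with | h x
  induction y using ind with | h y
  induction z using ind with | h z
  induction w using ind with | h w
  exact cls_le.2 (.alt h h')

theorem act_mono (α : Act A) {x y : Proc A} (h : x ≤ y) : act α x ≤ act α y := by
  induction x using ind with | h x
  induction y using ind with | h y
  exact cls_le.2 (.pre α h)

theorem act_tau (α : Act A) (x : Proc A) : act α (act tau x) = act α x := by
  simpa only [add_self] using act_add α x x

theorem tau_add_self (x : Proc A) : act tau x + x = act tau x :=
  le_antisymm ((add_mono le_rfl (le_tau x)).trans (add_self _).le)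
    (by simpa only [add_self] using tau_add_le x x)

theorem tau_tau_add (x y : Proc A) : act tau (act tau x + y) = act tau x + y :=
  le_antisymm (by simpa only [act_tau] using tau_add_le (act tau x) y) (le_tau _)

end Proc

open Proc

/-! ### Ground-completeness -/

theorem cls_add_tau_of_step {p p' : Term A} (h : Step p tau p') :
    cls p + act tau (cls p') = cls p := by
  generalize hα : (tau : Act A) = α at h
  induction h with
  | pre α t =>
    subst hα
    exact add_self _
  | altLeft _ ih =>
    rw [cls_alt, add_right_comm, ih hα]
  | altRight _ ih =>
    rw [cls_alt, add_assoc, ih hα]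

theorem cls_add_tau_of_transGen {p p' : Term A}
    (h : Relation.TransGen (fun s s' => Step s tau s') p p') :
    cls p + act tau (cls p') = cls p := by
  induction h using Relation.TransGen.head_induction_on with
  | single h => exact cls_add_tau_of_step h
  | @head p q h _ ih =>
    -- By induction `q` has a summand `τ p'`, and WIF2' with W1 makes a leading `τ` redundant on
    -- such a term.
    have hq : act tau (cls q) = cls q := by
      rw [← ih, add_comm, tau_tau_add]
    rw [← cls_add_tau_of_step h, hq, add_assoc, ih]

theorem cls_add_tau_of_strictRun {p p' : Term A} (h : StrictRun p [] p') :
    cls p + act tau (cls p') = cls p := by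
  obtain ⟨α, p₁, v, hs, hv, hr⟩ := h
  cases α with
  | some a => simp at hv
  | none =>
    obtain rfl : v = [] := by simpa using hv.symm
    cases hr with
    | nil hr => exact cls_add_tau_of_transGen (.head' hs hr)

theorem closed_alt {t u : Term A} : (alt t u).Closed ↔ t.Closed ∧ u.Closed :=
  Set.union_empty_iff

theorem Closed.step {p p' : Term A} {α : Act A} (hp : p.Closed) (h : Step p α p') :
    p'.Closed := by
  induction h with
  | pre => exact hp
  | altLeft _ ih => exact ih (closed_alt.1 hp).1
  | altRight _ ih => exact ih (closed_alt.1 hp).2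

theorem Closed.tauStar {p p' : Term A} (hp : p.Closed) (h : TauStar Step p p') : p'.Closed := by
  induction h with
  | refl => exact hp
  | tail _ h ih => exact Closed.step ih h

theorem Closed.weakRun {p p' : Term A} {w : List A} (hp : p.Closed) (h : WeakRun Step p w p') :
    p'.Closed := by
  induction h with
  | nil h => exact Closed.tauStar hp h
  | cons h₁ h₂ _ ih => exact ih (Closed.step (Closed.tauStar hp h₁) h₂)

/-- All weak `a`-derivatives of a term can be collected in a single summand. -/
theorem exists_derivative (a : A) (p : Term A) (hp : p.Closed) :
    (∀ w p', ¬ StrictRun p (a :: w) p') ∨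
    ∃ s : Term A, s.Closed ∧ cls p + act (some a) (cls s) = cls p ∧
      ∀ w p', StrictRun p (a :: w) p' → WeakRun Step s w p' := by
  induction p with
  | var n => exact absurd hp (Set.singleton_ne_empty n)
  | nil => exact .inl fun _ _ => not_strictRun_nil
  | pre α t ih =>
    cases α with
    | none =>
      simp only [strictRun_tau, weakRun_iff (w := a :: _), reduceCtorEq, false_and, false_or]
      refine (ih hp).imp_right ?_
      rintro ⟨s, hs, he, h⟩
      refine ⟨s, hs, ?_, h⟩
      -- `τ t` absorbs `t`, which absorbs `a s`.
      rw [cls_pre, ← tau_add_self, add_assoc, he]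
    | some b =>
      by_cases hab : a = b
      · subst hab
        refine .inr ⟨t, hp, add_self _, fun w p' h => ?_⟩
        obtain ⟨v, hv, h⟩ := strictRun_act.1 h
        obtain rfl : w = v := by simpa using hv
        exact h
      · refine .inl fun w p' h => hab ?_
        obtain ⟨v, hv, -⟩ := strictRun_act.1 h
        exact (List.cons.inj hv).1
  | alt t u iht ihu =>
    obtain ⟨ht, hu⟩ := closed_alt.1 hp
    simp only [strictRun_alt, cls_alt]
    rcases iht ht with iht | ⟨s, hs, hse, hsr⟩ <;> rcases ihu hu with ihu | ⟨r, hr, hre, hrr⟩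
    · exact .inl fun w p' h => h.elim (iht w p') (ihu w p')
    · exact .inr ⟨r, hr, by rw [add_assoc, hre],
        fun w p' h => h.elim (fun h => absurd h (iht w p')) (hrr w p')⟩
    · exact .inr ⟨s, hs, by rw [add_right_comm, hse],
        fun w p' h => h.elim (hsr w p') (fun h => absurd h (ihu w p'))⟩
    -- WIF1 turns the absorbed summands `a s + a r` into `a (τ s + τ r)`.
    · refine .inr ⟨alt (pre tau s) (pre tau r), closed_alt.2 ⟨hs, hr⟩, ?_, fun w p' h => ?_⟩
      · rw [cls_alt, cls_pre, cls_pre, act_add, add_add_add_comm, hse, hre]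
      · refine StrictRun.weakRun (strictRun_alt.2 (h.imp (fun h => ?_) fun h => ?_))
        exacts [strictRun_tau.2 (hsr w p' h), strictRun_tau.2 (hrr w p' h)]

/-- A summand that adds no weak traces may be added on the right. -/
theorem cls_le_add_of_weakTraces_subset {p r : Term A} (hp : p.Closed) (hr : r.Closed)
    (h : weakTraces Step r ⊆ weakTraces Step p) : cls p ≤ cls p + cls r := by
  induction r generalizing p with
  | var n => exact absurd hr (Set.singleton_ne_empty n)
  | nil => exact (add_zero (cls p)).ge
  | alt t u iht ihu =>
    obtain ⟨ht, hu⟩ := closed_alt.1 hr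
    rw [weakTraces_alt, Set.union_subset_iff] at h
    have := add_mono (iht hp ht h.1) (ihu hp hu h.2)
    rwa [add_self, add_add_add_comm, add_self] at this
  | pre α r ih =>
    cases α with
    | none =>
      rw [weakTraces_tau] at h
      exact (ih hp hr h).trans (add_mono le_rfl (le_tau _))
    | some a =>
      have hmem : ∀ w ∈ weakTraces Step r, ∃ p', StrictRun p (a :: w) p' := by
        intro w hw
        simpa [mem_weakTraces_iff (p := p)] using
          h (mem_weakTraces_pre.2 (.inr ⟨w, hw, rfl⟩))
      rcases exists_derivative a p hp with hn | ⟨s, hs, he, hsr⟩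
      · obtain ⟨p', hp'⟩ := hmem [] (nil_mem_weakTraces r)
        exact absurd hp' (hn _ _)
      -- All traces of `p` after `a` are traces of `s`, so induction gives `s ≤ s + r`. Weakening by
      -- W1 gives the shape that WIF1 splits into `a s + a r` under `a`.
      · have hle : cls s ≤ act tau (cls s) + act tau (cls r) :=
          (ih hs hr fun w hw => (hmem w hw).imp fun p' hp' => hsr w p' hp').trans
            (add_mono (le_tau _) (le_tau _))
        have := add_mono (le_refl (cls p)) (act_mono (some a) hle)
        rwa [act_add, ← add_assoc, he] at this

/-- The run of `τ t` stopping at `t` is matched by some `q'` with no more traces than `t`. Hence `τ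
t ≤ τ (t + q') ≤ τ q' + t` by WIF2'; `q` absorbs `τ q'`, and `ih` removes `t`. -/
theorem tau_add_le_of_dominated {t q : Term A} (ht : t.Closed) (hq : q.Closed)
    (ih : Dominated t q → cls t + cls q ≤ cls q) (h : Dominated (pre tau t) q) :
    act tau (cls t) + cls q ≤ cls q := by
  obtain ⟨q', hr, hs⟩ := h [] t (strictRun_tau.2 (.self t))
  have hle : act tau (cls t) ≤ act tau (cls q') + cls t := by
    refine (act_mono tau (cls_le_add_of_weakTraces_subset ht (Closed.weakRun hq hr.weakRun)
      hs)).trans ?_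
    rw [add_comm]
    exact tau_add_le _ _
  calc act tau (cls t) + cls q ≤ act tau (cls q') + cls t + cls q := add_mono hle le_rfl
    _ = act tau (cls q') + (cls t + cls q) := add_assoc _ _ _
    _ ≤ act tau (cls q') + cls q :=
      add_mono le_rfl (ih fun w p' hp => h w p' (strictRun_tau.2 hp.weakRun))
    _ = cls q := by rw [add_comm, cls_add_tau_of_strictRun hr]

/-- A dominated summand may be dropped on the right. -/
theorem add_le_of_dominated {p q : Term A} (hp : p.Closed) (hq : q.Closed)
    (h : Dominated p q) : cls p + cls q ≤ cls q := by
  induction p generalizing q with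
  | var n => exact absurd hp (Set.singleton_ne_empty n)
  | nil => exact (zero_add (cls q)).le
  | alt t u iht ihu =>
    obtain ⟨ht, hu⟩ := closed_alt.1 hp
    rw [cls_alt, add_assoc]
    exact (add_mono le_rfl
      (ihu hu hq fun w p' hp => h w p' (strictRun_alt.2 (.inr hp)))).trans
      (iht ht hq fun w p' hp => h w p' (strictRun_alt.2 (.inl hp)))
  | pre α t ih =>
    cases α with
    | none => exact tau_add_le_of_dominated hp hq (ih hp hq) h
    | some a =>
      rcases exists_derivative a q hq with hn | ⟨s, hs, he, hsr⟩
      · obtain ⟨q', hq', -⟩ := h [a] t (strictRun_act.2 ⟨[], rfl, .self t⟩)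
        exact absurd hq' (hn _ _)
      -- Every weak `a`-derivative of `q` is reachable from `s`, so domination of `a t` by `q`
      -- becomes domination of `τ t` by `τ s`. Prefixing with `a` and applying WIF1 gives `a t + a s
      -- ≤ a s`, where `q` absorbs `a s`.
      · have hle : act tau (cls t) + act tau (cls s) ≤ act tau (cls s) := by
          refine tau_add_le_of_dominated (q := pre tau s) hp hs (ih hp hs) fun w t' ht' => ?_
          obtain ⟨q', hq', hsub⟩ := h (a :: w) t' (strictRun_act.2 ⟨w, rfl, strictRun_tau.1 ht'⟩)
          exact ⟨q', strictRun_tau.2 (hsr w q' hq'), hsub⟩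
        have := add_mono (le_refl (cls q)) (act_mono (some a) hle)
        rwa [act_add, act_tau, he, add_left_comm, he] at this

theorem groundComplete_wifAxioms : GroundComplete (wifAxioms A) TermWIFle := by
  intro p q hp hq h
  obtain ⟨h₁, h₂⟩ := termWIFle_iff.1 h
  exact cls_le.1 ((cls_le_add_of_weakTraces_subset hp hq h₂).trans (add_le_of_dominated hp hq h₁))

end BCCS

theorem mainTheorem4 (A : Type*) [Nonempty A] [Countable A] :
    BCCS.FiniteUpToActionNames (BCCS.wifAxioms A) ∧
    (Finite A → (BCCS.wifAxioms A).Finite) ∧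
    BCCS.Sound (BCCS.wifAxioms A) BCCS.TermWIFle ∧
    BCCS.GroundComplete (BCCS.wifAxioms A) BCCS.TermWIFle :=
  ⟨BCCS.finiteUpToActionNames_wifAxioms, fun _ => BCCS.finite_wifAxioms, BCCS.sound_wifAxioms,
    BCCS.groundComplete_wifAxioms⟩
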